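/- All graphs are finite, simple and undirected; let $\kappa$ be a positive integer and $[\kappa]=\{1,\dots,\kappa\}$. A cover of a graph $G$ is a graph $H$ with vertex set $\bigcup_{v\in V(G)}X_v$, where $X_v=\{(v,1),\dots,(v,\kappa)\}$, and edge set $\bigcup_{uv\in E(G)}\mathscr M_{uv}$, where $\mathscr M_{uv}$ is a (possibly empty) matching between $X_u$ and $X_v$. Given $f:V(H)\to\mathbb Z_{\ge 0}$, the pair $(H,f)$ is called a valued cover of $G$. A transversal of $H$ is a set $R\subseteq V(H)$ with $|R\cap X_v|=1$ for every $v\in V(G)$; it is strictly $f$-degenerate if every nonempty subgraph $\Gamma$ of $H[R]$ has a vertex $x$ with $\deg_\Gamma(x)<f(x)$. For $v\in V(G)$, the graph $H-X_v$ is regarded as a cover of $G-v$, with $f$ restricted to its vertices. The pair $(H,f)$ is minimal non-strictly $f$-degenerate if $H$ has no strictly $f$-degenerate transversal, but for every $v\in V(G)$ the cover $H-X_v$ has a strictly $f$-degenerate transversal. A graph is 2-connected if it has at least three vertices, is connected, and remains connected after the deletion of any one vertex. **Theorem.** Let $G$ be a graph and let $(H,f)$ be a valued cover of $G$ that is minimal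 non-strictly $f$-degenerate. Let $F$ be a 2-connected (not necessarily induced) subgraph of $G$ such that $\sum_{q=1}^{\kappa} f(v,q)\ge \deg_G(v)$ for every $v\in V(F)$, and let $G'=G[V(F)]$. Then $G'$ is a cycle, or $G'$ is a complete graph, or $\deg_{G'}(v)\le \max_{q\in[\kappa]} f(v,q)$ for every $v\in V(G')$. -/

import Mathlib

/-- A finite graph `K` is strictly `f`-degenerate if every nonempty subgraph `Γ` of `K` has a
vertex `v` with `deg_Γ(v) < f v`. -/
def StrictlyDegenerate {W : Type*} [Finite W] (K : SimpleGraph W) (f : W → ℕ) : Prop :=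
  ∀ Γ : K.Subgraph, Γ.verts.Nonempty → ∃ v ∈ Γ.verts, (Γ.neighborSet v).ncard < f v

/-- `H` is a cover of `G` with `κ` colours: its vertex set is the union of the fibres
`X_v = {(v, q) | q ∈ [κ]}`, its edges lie over edges of `G`, and over every edge `uv` of `G` the
edges between `X_u` and `X_v` form a (possibly empty) matching. -/
structure IsCover {V : Type*} {κ : ℕ} (G : SimpleGraph V) (H : SimpleGraph (V × Fin κ)) :
    Prop where
  adj_base : ∀ ⦃x y : V × Fin κ⦄, H.Adj x y → G.Adj x.1 y.1
  matching : ∀ ⦃x y z : V × Fin κ⦄, H.Adj x y → H.Adj x z → y.1 = z.1 → y = z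

/-- The fibre `X_v = {(v, q) | q ∈ [κ]}`. -/
def coverFiber {V : Type*} (κ : ℕ) (v : V) : Set (V × Fin κ) := {x | x.1 = v}

/-- `R` is a transversal of the restriction `H_S = H[⋃_{v ∈ S} X_v]` of a cover `H` to a vertex
set `S` of the base graph: `R` is a set of vertices of `H_S` that meets each fibre `X_v`, `v ∈ S`,
in exactly one vertex. -/
def IsTransversalOn {V : Type*} {κ : ℕ} (S : Set V) (R : Set (V × Fin κ)) : Prop :=
  R ⊆ (⋃ v ∈ S, coverFiber κ v) ∧ ∀ v ∈ S, (R ∩ coverFiber κ v).ncard = 1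

/-- `H_S` has a strictly `f`-degenerate transversal. (For `R ⊆ V(H_S)`, the subgraphs of `H_S`
and of `H` induced by `R` coincide.) -/
def HasStrictlyDegenerateTransversalOn {V : Type*} [Finite V] {κ : ℕ}
    (H : SimpleGraph (V × Fin κ)) (f : V × Fin κ → ℕ) (S : Set V) : Prop :=
  ∃ R : Set (V × Fin κ), IsTransversalOn S R ∧
    StrictlyDegenerate (H.induce R) (fun x => f x.1)

/-- `(H, f)` is minimal non-strictly `f`-degenerate: `H` has no strictly `f`-degenerate
transversal, but `H - X_v` (the restriction of `H` to the complement of `{v}`) has one for each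
vertex `v` of the base graph. -/
def MinimalNonStrictlyDegenerate {V : Type*} [Finite V] {κ : ℕ}
    (H : SimpleGraph (V × Fin κ)) (f : V × Fin κ → ℕ) : Prop :=
  ¬ HasStrictlyDegenerateTransversalOn H f Set.univ ∧
    ∀ v : V, HasStrictlyDegenerateTransversalOn H f {v}ᶜ

/-- A finite graph is 2-connected if it has at least three vertices, is connected, and stays
connected after the deletion of any one vertex. -/
def IsTwoConnected {W : Type*} [Finite W] (K : SimpleGraph W) : Prop :=
  3 ≤ Nat.card W ∧ K.Connected ∧ ∀ w : W, (K.induce {w}ᶜ).Connected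

/-- A graph is a cycle if it is isomorphic to `C_n` for some `n ≥ 3`. -/
def IsCycleGraph {W : Type*} (K : SimpleGraph W) : Prop :=
  ∃ n : ℕ, 3 ≤ n ∧ Nonempty (K ≃g SimpleGraph.cycleGraph n)

set_option linter.unusedSectionVars false

namespace DegenerateCover

open Finset

open scoped Classical in
/-- The number of neighbours of `v` in `S`. -/
noncomputable def degIn {V : Type*} (G : SimpleGraph V) (S : Finset V) (v : V) : ℕ :=
  #{u ∈ S | G.Adj v u}

open scoped Classical in
/-- The number of neighbours of the cover vertex `x` among the vertices of `Q` coloured by `φ`. -/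
noncomputable def hits {V : Type*} {κ : ℕ} (H : SimpleGraph (V × Fin κ)) (φ : V → Fin κ)
    (Q : Finset V) (x : V × Fin κ) : ℕ :=
  #{u ∈ Q | H.Adj x (u, φ u)}

/-- The transversal over `S` given by the colouring `φ` is strictly `f`-degenerate. -/
def IsGoodOn {V : Type*} {κ : ℕ} (H : SimpleGraph (V × Fin κ)) (f : V × Fin κ → ℕ)
    (S : Finset V) (φ : V → Fin κ) : Prop :=
  ∀ T ⊆ S, T.Nonempty → ∃ v ∈ T, hits H φ T (v, φ v) < f (v, φ v)

/-- No colouring gives a strictly `f`-degenerate transversal over `S`. -/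
def IsBadOn {V : Type*} {κ : ℕ} (H : SimpleGraph (V × Fin κ)) (f : V × Fin κ → ℕ)
    (S : Finset V) : Prop :=
  ∀ φ, ¬ IsGoodOn H f S φ

/-- The values of `f` that remain after `Q` has been coloured by `φ`. -/
noncomputable def residual {V : Type*} {κ : ℕ} (H : SimpleGraph (V × Fin κ))
    (f : V × Fin κ → ℕ) (φ : V → Fin κ) (Q : Finset V) (x : V × Fin κ) : ℕ :=
  f x - hits H φ Q x

/-- The set `S` induces a connected subgraph (or is empty): every proper nonempty part of it is
joined to the rest. -/
def IsLinked {V : Type*} [DecidableEq V] (G : SimpleGraph V) (S : Finset V) : Prop :=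
  ∀ T ⊆ S, T.Nonempty → T ≠ S → ∃ u ∈ T, ∃ v ∈ S \ T, G.Adj u v

/-- The set `S` has at least two elements and induces a connected subgraph without cut vertex. -/
def IsNonsep {V : Type*} [DecidableEq V] (G : SimpleGraph V) (S : Finset V) : Prop :=
  2 ≤ #S ∧ IsLinked G S ∧ ∀ x ∈ S, IsLinked G (S.erase x)

/-- The values of `f` on the fibres over `S` sum up to at least the degrees in `S`. -/
def IsLarge {V : Type*} {κ : ℕ} (G : SimpleGraph V) (f : V × Fin κ → ℕ) (S : Finset V) : Prop :=
  ∀ v ∈ S, degIn G S v ≤ ∑ q, f (v, q)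

/-! ### Greedy colouring, residual values and positive colours. -/

section

variable {V : Type*} [DecidableEq V] {κ : ℕ} {G : SimpleGraph V} {H : SimpleGraph (V × Fin κ)}
  {f : V × Fin κ → ℕ} {S Q U T : Finset V} {φ ψ : V → Fin κ}

theorem degIn_mono (h : S ⊆ U) (v : V) : degIn G S v ≤ degIn G U v := by
  classical exact card_le_card (filter_subset_filter _ h)

theorem degIn_union (h : Disjoint S Q) (v : V) :
    degIn G (S ∪ Q) v = degIn G S v + degIn G Q v := by
  classical
  unfold degIn
  rw [filter_union, card_union_of_disjoint (disjoint_filter_filter h)]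

theorem degIn_singleton_of_adj {u v : V} (h : G.Adj v u) : degIn G {u} v = 1 := by
  simp [degIn, filter_singleton, h]

theorem degIn_singleton_of_not_adj {u v : V} (h : ¬ G.Adj v u) : degIn G {u} v = 0 := by
  simp [degIn, filter_singleton, h]

theorem degIn_erase_of_adj {x v : V} (hx : x ∈ S) (h : G.Adj v x) :
    degIn G (S.erase x) v + 1 = degIn G S v := by
  have := degIn_union (G := G) (S := S.erase x) (Q := {x}) (by simp) v
  rw [degIn_singleton_of_adj h, union_singleton, insert_erase hx] at this
  exact this.symm

theorem hits_mono (h : S ⊆ U) (x : V × Fin κ) : hits H φ S x ≤ hits H φ U x := by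
  classical exact card_le_card (filter_subset_filter _ h)

theorem hits_congr (h : ∀ v ∈ S, φ v = ψ v) (x : V × Fin κ) : hits H φ S x = hits H ψ S x := by
  classical
  unfold hits
  congr 1
  apply filter_congr
  intro u hu
  rw [h u hu]

theorem hits_union (h : Disjoint S Q) (x : V × Fin κ) :
    hits H φ (S ∪ Q) x = hits H φ S x + hits H φ Q x := by
  classical
  unfold hits
  rw [filter_union, card_union_of_disjoint (disjoint_filter_filter h)]

theorem hits_singleton_of_adj {x : V × Fin κ} {u : V} (h : H.Adj x (u, φ u)) :
    hits H φ {u} x = 1 := by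
  simp [hits, filter_singleton, h]

theorem hits_singleton_of_not_adj {x : V × Fin κ} {u : V} (h : ¬ H.Adj x (u, φ u)) :
    hits H φ {u} x = 0 := by
  simp [hits, filter_singleton, h]

theorem hits_eq_zero (hH : IsCover G H) {v : V} (h : ∀ u ∈ S, ¬ G.Adj v u) (q : Fin κ) :
    hits H φ S (v, q) = 0 := by
  classical
  unfold hits
  rw [card_eq_zero, filter_eq_empty_iff]
  exact fun u hu hadj => h u hu (hH.adj_base hadj)

/-- Since the edges over $uv$ form a matching, a coloured neighbour $u$ hits at most one colour of
$v$. -/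
theorem sum_hits_le (hH : IsCover G H) (φ : V → Fin κ) (Q : Finset V) (v : V) :
    ∑ q, hits H φ Q (v, q) ≤ degIn G Q v := by
  classical
  unfold hits degIn
  simp_rw [card_filter]
  rw [sum_comm]
  refine sum_le_sum fun u _ => ?_
  rw [← card_filter]
  split_ifs with h
  · refine card_le_one.2 fun p hp q hq => ?_
    simp only [mem_filter, mem_univ, true_and] at hp hq
    simpa using hH.matching hp.symm hq.symm rfl
  · rw [Nat.le_zero, card_eq_zero, filter_eq_empty_iff]
    exact fun q _ hadj => h (hH.adj_base hadj)

theorem exists_hits_lt (hH : IsCover G H) (φ : V → Fin κ) {v : V}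
    (h : degIn G Q v < ∑ q, f (v, q)) : ∃ q, hits H φ Q (v, q) < f (v, q) := by
  by_contra! hc
  have h1 : ∑ q, f (v, q) ≤ ∑ q, hits H φ Q (v, q) := sum_le_sum fun q _ => hc q
  have h2 := sum_hits_le hH φ Q v
  omega

theorem IsGoodOn.insert_update (h : IsGoodOn H f Q φ) {v : V} (hv : v ∉ Q) {q : Fin κ}
    (hq : hits H φ Q (v, q) < f (v, q)) :
    IsGoodOn H f (insert v Q) (Function.update φ v q) := by
  have hcongr : ∀ T : Finset V, v ∉ T → ∀ x, hits H (Function.update φ v q) T x = hits H φ T x :=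
    fun T hT x => hits_congr (fun u hu => Function.update_of_ne (ne_of_mem_of_not_mem hu hT) _ _) x
  intro T hT hne
  by_cases hvT : v ∈ T
  · refine ⟨v, hvT, ?_⟩
    have hTv : T = T.erase v ∪ {v} := by rw [union_singleton, insert_erase hvT]
    rw [hTv, hits_union (by simp), Function.update_self,
      hits_singleton_of_not_adj (by simp), hcongr _ (by simp)]
    refine lt_of_le_of_lt (hits_mono ?_ _) hq
    exact fun u hu => (mem_insert.1 (hT (mem_of_mem_erase hu))).resolve_left (ne_of_mem_erase hu)
  · have hTQ : T ⊆ Q := fun u hu =>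
      (mem_insert.1 (hT hu)).resolve_left (by rintro rfl; exact hvT hu)
    obtain ⟨u, hu, hlt⟩ := h T hTQ hne
    refine ⟨u, hu, ?_⟩
    rw [hcongr T hvT, Function.update_of_ne (by rintro rfl; exact hvT hu)]
    exact hlt

/-- Otherwise the two colourings could be glued: a part meeting $S$ has a witness in $S$, since
`residual` has already paid for all neighbours in $Q$, and any other part lies in $Q$. A colour
whose value is used up has residual $0$ and can never be a witness, so truncated subtraction is
harmless. -/
theorem IsBadOn.residual_left (hbad : IsBadOn H f (S ∪ Q)) (hdisj : Disjoint S Q)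
    (hφ : IsGoodOn H f Q φ) : IsBadOn H (residual H f φ Q) S := by
  intro ψ hψ
  apply hbad (fun v => if v ∈ Q then φ v else ψ v)
  have hQ : ∀ T ⊆ Q, ∀ x, hits H (fun v => if v ∈ Q then φ v else ψ v) T x = hits H φ T x :=
    fun T hT x => hits_congr (fun u hu => by simp [hT hu]) x
  have hS : ∀ T ⊆ S, ∀ x, hits H (fun v => if v ∈ Q then φ v else ψ v) T x = hits H ψ T x :=
    fun T hT x => hits_congr (fun u hu => by simp [disjoint_left.1 hdisj (hT hu)]) x
  intro T hT hne
  by_cases hTS : (T ∩ S).Nonempty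
  · obtain ⟨v, hv, hlt⟩ := hψ (T ∩ S) inter_subset_right hTS
    obtain ⟨hvT, hvS⟩ := mem_inter.1 hv
    refine ⟨v, hvT, ?_⟩
    have hsplit : T = T ∩ S ∪ T ∩ Q := by rw [← inter_union_distrib_left, inter_eq_left.2 hT]
    rw [hsplit, hits_union (hdisj.mono inter_subset_right inter_subset_right)]
    simp only [disjoint_left.1 hdisj hvS, if_false]
    rw [hS _ inter_subset_right, hQ _ inter_subset_right]
    have := hits_mono (H := H) (φ := φ) (inter_subset_right : T ∩ Q ⊆ Q) (v, ψ v)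
    unfold residual at hlt
    omega
  · have hTQ : T ⊆ Q := fun u hu => (mem_union.1 (hT hu)).resolve_left fun hu' =>
      hTS ⟨u, mem_inter.2 ⟨hu, hu'⟩⟩
    obtain ⟨v, hv, hlt⟩ := hφ T hTQ hne
    exact ⟨v, hv, by simpa only [hTQ hv, if_true, hQ T hTQ] using hlt⟩

/-- A neighbour in $Q$ costs the degree one unit and the value sum at most one; truncation only
increases the residual sum. -/
theorem IsLarge.residual_left (hH : IsCover G H) (hf : ∀ v ∈ S, degIn G (S ∪ Q) v ≤ ∑ q, f (v, q))
    (hdisj : Disjoint S Q) (φ : V → Fin κ) : IsLarge G (residual H f φ Q) S := by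
  intro v hv
  have h1 := hf v hv
  rw [degIn_union hdisj] at h1
  have h2 := sum_hits_le hH φ Q v
  have h3 : ∑ q, f (v, q) ≤
      ∑ q, residual H f φ Q (v, q) + ∑ q, hits H φ Q (v, q) := by
    rw [← sum_add_distrib]
    refine sum_le_sum fun q _ => ?_
    unfold residual
    omega
  omega

/-- Greedy colouring towards the vertices outside `Q`. -/
theorem exists_isGoodOn (hH : IsCover G H) (hκ : 0 < κ)
    (hlink : ∀ T ⊆ Q, T.Nonempty → ∃ u ∈ T, ∃ v ∈ U \ T, G.Adj u v) (hQU : Q ⊆ U)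
    (hf : ∀ v ∈ Q, degIn G U v ≤ ∑ q, f (v, q)) : ∃ φ, IsGoodOn H f Q φ := by
  induction hn : #Q generalizing Q with
  | zero =>
    refine ⟨fun _ => ⟨0, hκ⟩, fun T hT hne => ?_⟩
    rw [card_eq_zero] at hn
    subst hn
    exact absurd hne (by simp [subset_empty.1 hT])
  | succ n ih =>
    obtain ⟨u, hu, v, hv, huv⟩ := hlink Q Subset.rfl (card_pos.1 (by omega))
    have hsub : Q.erase u ⊆ Q := erase_subset _ _
    obtain ⟨φ, hφ⟩ := ih (Q := Q.erase u) (fun T hT => hlink T (hT.trans hsub))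
      (hsub.trans hQU) (fun w hw => hf w (hsub hw)) (by rw [card_erase_of_mem hu]; omega)
    obtain ⟨hvU, hvQ⟩ := mem_sdiff.1 hv
    -- The vertex `u` is coloured last while its neighbour `v` stays uncoloured, so one unit of
    -- value is spare.
    have hlt : degIn G (Q.erase u) u < ∑ q, f (u, q) := by
      refine lt_of_lt_of_le ?_ (hf u hu)
      rw [← degIn_erase_of_adj hvU huv]
      exact Nat.lt_succ_of_le (degIn_mono (fun w hw => mem_erase.2
        ⟨by rintro rfl; exact hvQ (hsub hw), hQU (hsub hw)⟩) _)
    obtain ⟨q, hq⟩ := exists_hits_lt hH φ hlt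
    have := hφ.insert_update (by simp) hq
    rw [insert_erase hu] at this
    exact ⟨_, this⟩

/-- On a connected set without strictly degenerate transversal the value sums are the degrees. -/
theorem IsBadOn.sum_eq (hH : IsCover G H) (hκ : 0 < κ) (hbad : IsBadOn H f U)
    (hU : IsLinked G U) (hf : IsLarge G f U) {v : V} (hv : v ∈ U) :
    ∑ q, f (v, q) = degIn G U v := by
  refine le_antisymm ?_ (hf v hv)
  by_contra! hlt
  -- With strict surplus at `v`, the rest can be coloured greedily towards `v`, and `v` still has a
  -- free colour.
  obtain ⟨φ, hφ⟩ := exists_isGoodOn (Q := U.erase v) hH hκ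
    (fun T hT hne => hU T (hT.trans (erase_subset _ _)) hne
      (by rintro rfl; exact absurd (hT hv) (by simp)))
    (erase_subset _ _) (fun w hw => hf w (mem_of_mem_erase hw))
  obtain ⟨q, hq⟩ := exists_hits_lt hH φ
    (lt_of_le_of_lt (degIn_mono (erase_subset v U) v) hlt)
  have := hφ.insert_update (by simp) hq
  rw [insert_erase hv] at this
  exact hbad _ this

theorem isGoodOn_singleton {x : V} (h : 0 < f (x, φ x)) : IsGoodOn H f {x} φ := by
  intro T hT hne
  obtain rfl := (subset_singleton_iff.1 hT).resolve_left hne.ne_empty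
  exact ⟨x, by simp, by rwa [hits_singleton_of_not_adj (by simp)]⟩

theorem IsBadOn.residual_erase (hbad : IsBadOn H f U) {x : V} (hx : x ∈ U)
    (h : 0 < f (x, φ x)) : IsBadOn H (residual H f φ {x}) (U.erase x) :=
  IsBadOn.residual_left (by rwa [union_singleton, insert_erase hx]) (by simp) (isGoodOn_singleton h)

theorem IsLarge.residual_erase (hH : IsCover G H) (hf : IsLarge G f U) {x : V} (hx : x ∈ U)
    (φ : V → Fin κ) : IsLarge G (residual H f φ {x}) (U.erase x) :=
  IsLarge.residual_left hH (fun v hv => by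
    rw [union_singleton, insert_erase hx]
    exact hf v (mem_of_mem_erase hv)) (by simp) φ

theorem residual_of_not_adj {x : V} {y : V × Fin κ} (h : ¬ H.Adj y (x, φ x)) :
    residual H f φ {x} y = f y := by
  simp [residual, hits_singleton_of_not_adj h]

theorem residual_of_adj {x : V} {y : V × Fin κ} (h : H.Adj y (x, φ x)) :
    residual H f φ {x} y = f y - 1 := by
  simp [residual, hits_singleton_of_adj h]

/-- Colouring $x$ by $c$ lowers the degree of $y$ by one. Since value sums equal degrees on both $U$
and $U-x$, the value sum at $y$ must drop too. -/
theorem IsBadOn.exists_adj (hH : IsCover G H) (hbad : IsBadOn H f U)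
    (hU : IsLinked G U) (hf : IsLarge G f U) {x y : V} (hx : x ∈ U)
    (hUx : IsLinked G (U.erase x)) (hy : y ∈ U) (hxy : G.Adj y x) {c : Fin κ}
    (hc : 0 < f (x, c)) : ∃ q, H.Adj (y, q) (x, c) ∧ 0 < f (y, q) := by
  have hκ : 0 < κ := c.pos
  by_contra! hcon
  have hye : y ∈ U.erase x := mem_erase.2 ⟨hxy.ne, hy⟩
  have h1 := hbad.sum_eq hH hκ hU hf hy
  have h2 := (hbad.residual_erase (φ := fun _ => c) hx hc).sum_eq hH hκ hUx
    (hf.residual_erase hH hx _) hye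
  have h3 := degIn_erase_of_adj hx hxy
  have h4 : ∑ q, residual H f (fun _ => c) {x} (y, q) = ∑ q, f (y, q) := by
    refine sum_congr rfl fun q _ => ?_
    by_cases hq : H.Adj (y, q) (x, c)
    · rw [residual_of_adj hq]
      have := hcon q hq
      omega
    · exact residual_of_not_adj hq
  omega

/-- The number of colours of positive value at `v`. -/
def suppCard (f : V × Fin κ → ℕ) (v : V) : ℕ := #{q | 0 < f (v, q)}

theorem IsBadOn.suppCard_le (hH : IsCover G H) (hbad : IsBadOn H f U) (hU : IsNonsep G U)
    (hf : IsLarge G f U) {x y : V} (hx : x ∈ U) (hy : y ∈ U) (hxy : G.Adj y x) :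
    suppCard f x ≤ suppCard f y := by
  have h : ∀ c, 0 < f (x, c) → ∃ q, H.Adj (y, q) (x, c) ∧ 0 < f (y, q) := fun c hc =>
    hbad.exists_adj hH hU.2.1 hf hx (hU.2.2 x hx) hy hxy hc
  choose! g hg using h
  refine card_le_card_of_injOn g (fun c hc => ?_) fun c hc d hd hcd => ?_
  · simpa using (hg c (by simpa using hc)).2
  · have h1 := (hg c (by simpa using hc)).1
    have h2 := (hg d (by simpa using hd)).1
    rw [← hcd] at h2
    simpa using hH.matching h1 h2 rfl

theorem IsBadOn.suppCard_eq (hH : IsCover G H) (hbad : IsBadOn H f U) (hU : IsNonsep G U)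
    (hf : IsLarge G f U) {x y : V} (hx : x ∈ U) (hy : y ∈ U) :
    suppCard f x = suppCard f y := by
  classical
  by_contra hne
  obtain ⟨u, hu, v, hv, huv⟩ := hU.2.1 {z ∈ U | suppCard f z = suppCard f x} (filter_subset _ _)
    ⟨x, by simp [hx]⟩ (fun h => by
      rw [← h] at hy
      exact hne (mem_filter.1 hy).2.symm)
  simp only [mem_filter, mem_sdiff, not_and] at hu hv
  have h1 := hbad.suppCard_le hH hU hf hu.1 hv.1 huv.symm
  have h2 := hbad.suppCard_le hH hU hf hv.1 hu.1 huv
  have := hv.2 hv.1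
  omega

/-- All pairs of distinct vertices of `S` are adjacent. -/
def IsCompleteOn (G : SimpleGraph V) (S : Finset V) : Prop :=
  ∀ u ∈ S, ∀ v ∈ S, u ≠ v → G.Adj u v

theorem IsCompleteOn.mono (h : IsCompleteOn G U) (hS : S ⊆ U) : IsCompleteOn G S :=
  fun u hu v hv => h u (hS hu) v (hS hv)

theorem IsCompleteOn.isLinked (h : IsCompleteOn G S) : IsLinked G S := by
  intro T hT ⟨u, hu⟩ hne
  obtain ⟨v, hv, hvT⟩ := exists_of_ssubset (hT.ssubset_of_ne hne)
  exact ⟨u, hu, v, by simp [hv, hvT], h u (hT hu) v hv (by rintro rfl; exact hvT hu)⟩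

/-- On a complete set without strictly degenerate transversal, matched cover vertices have the same
value. -/
theorem IsBadOn.eq_of_isCompleteOn (hH : IsCover G H) (hbad : IsBadOn H f U)
    (hU : IsCompleteOn G U) (hf : IsLarge G f U) {u w : V} (hu : u ∈ U) (hw : w ∈ U)
    {p q : Fin κ} (hpq : H.Adj (u, p) (w, q)) (hp : 0 < f (u, p)) : f (u, p) = f (w, q) := by
  have hκ : 0 < κ := p.pos
  have hlink : ∀ x, IsLinked G (U.erase x) := fun x => (hU.mono (erase_subset _ _)).isLinked
  -- positivity passes along matching edges
  have hpos : ∀ {f : V × Fin κ → ℕ} {U : Finset V}, IsBadOn H f U → IsCompleteOn G U →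
      IsLarge G f U → ∀ {a b : V}, a ∈ U → b ∈ U → ∀ {c d : Fin κ}, H.Adj (a, c) (b, d) →
      0 < f (a, c) → 0 < f (b, d) := by
    intro f U hbad hU hf a b ha hb c d hcd hc
    obtain ⟨d', hd', hd0⟩ := hbad.exists_adj hH hU.isLinked hf ha
      (hU.mono (erase_subset _ _)).isLinked hb (hH.adj_base hcd).symm hc
    have := hH.matching hcd hd'.symm rfl
    rwa [this]
  induction hn : #U using Nat.strong_induction_on generalizing U f u w p q with
  | _ n ih =>
  subst hn
  have huw : u ≠ w := (hH.adj_base hpq).ne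
  by_cases hz : ∃ z ∈ U, z ≠ u ∧ z ≠ w
  · obtain ⟨z, hzU, hzu, hzw⟩ := hz
    have hq := hpos hbad hU hf hu hw hpq hp
    have huz : u ∈ U.erase z := mem_erase.2 ⟨hzu.symm, hu⟩
    have hwz : w ∈ U.erase z := mem_erase.2 ⟨hzw.symm, hw⟩
    have hUz : IsCompleteOn G (U.erase z) := hU.mono (erase_subset _ _)
    -- After colouring a third vertex `z` the induction hypothesis applies. If one of the values has
    -- become zero, so has the other, because positivity passes along matching edges.
    have key : ∀ (f' : V × Fin κ → ℕ), IsBadOn H f' (U.erase z) → IsLarge G f' (U.erase z) →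
        f' (u, p) = f' (w, q) := by
      intro f' hbad' hf'
      by_cases h0 : 0 < f' (u, p)
      · exact ih _ (card_erase_lt_of_mem hzU) hbad' hUz hf' huz hwz hpq h0
          (fun x => (hUz.mono (erase_subset _ _)).isLinked) rfl
      · by_cases h1 : 0 < f' (w, q)
        · exact absurd (hpos hbad' hUz hf' hwz huz hpq.symm h1) h0
        · omega
    obtain ⟨e, he, he0⟩ := hbad.exists_adj hH hU.isLinked hf hu (hlink u) hzU
      (hU z hzU u hu hzu) hp
    obtain ⟨e', he', he0'⟩ := hbad.exists_adj hH hU.isLinked hf hw (hlink w) hzU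
      (hU z hzU w hw hzw) hq
    have k1 := key _ (hbad.residual_erase (φ := fun _ => e) hzU he0)
      (hf.residual_erase hH hzU _)
    have k2 := key _ (hbad.residual_erase (φ := fun _ => e') hzU he0')
      (hf.residual_erase hH hzU _)
    -- If both partners at `z` coincide, both values drop by one together. Otherwise each value
    -- would exceed the other by one.
    by_cases hee : e = e'
    · subst hee
      rw [residual_of_adj (φ := fun _ => e) he.symm, residual_of_adj he'.symm] at k1
      omega
    · rw [residual_of_adj (φ := fun _ => e) he.symm, residual_of_not_adj] at k1
      · rw [residual_of_adj (φ := fun _ => e') he'.symm, residual_of_not_adj] at k2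
        · omega
        · intro h
          have := hH.matching he.symm h rfl
          simp [hee] at this
      · intro h
        have := hH.matching he'.symm h rfl
        simp [Ne.symm hee] at this
  · push Not at hz
    have hUeq : U = {u, w} := by
      ext z
      simp only [mem_insert, mem_singleton]
      refine ⟨fun h => ?_, ?_⟩
      · by_cases hzu : z = u
        · exact Or.inl hzu
        · exact Or.inr (hz z h hzu)
      · rintro (rfl | rfl) <;> assumption
    -- Only `u` and `w` are left, so the value sums are at most one and two positive values must
    -- both be one.
    have hone : ∀ {a b : V}, a ∈ U → U = {a, b} → ∀ c, f (a, c) ≤ 1 := by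
      intro a b ha hab c
      have h1 := hbad.sum_eq hH hκ hU.isLinked hf ha
      have h2 : degIn G U a ≤ 1 := by
        rw [hab, insert_eq, degIn_union (by
          rw [disjoint_singleton]; rintro rfl
          rw [hab] at hu hw; simp at hu hw; exact huw (hu.trans hw.symm)),
          degIn_singleton_of_not_adj (G.irrefl), zero_add]
        classical exact (card_filter_le _ _).trans (by simp)
      have h3 : f (a, c) ≤ ∑ q, f (a, q) :=
        single_le_sum (f := fun q => f (a, q)) (fun _ _ => Nat.zero_le _) (mem_univ c)
      omega
    have h1 := hone hu hUeq p
    have h2 := hone hw (by rw [hUeq, pair_comm]) q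
    have h3 := hpos hbad hU hf hu hw hpq hp
    omega

end

/-! ### Connected and nonseparable vertex sets; adding ears. -/

section

variable {V : Type*} [DecidableEq V] {G : SimpleGraph V} {S Q U P A B : Finset V}

theorem isLinked_of_notMem (z : V) (h : ∀ T ⊆ S, T.Nonempty → z ∉ T →
    ∃ u ∈ T, ∃ v ∈ S \ T, G.Adj u v) : IsLinked G S := by
  intro T hT hne hTS
  by_cases hz : z ∈ T
  · obtain ⟨u, hu, v, hv, huv⟩ := h (S \ T) sdiff_subset
      (sdiff_nonempty.2 fun h => hTS (hT.antisymm h)) (by simp [hz])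
    rw [Finset.sdiff_sdiff_eq_self hT] at hv
    exact ⟨v, hv, u, hu, huv.symm⟩
  · exact h T hT hne hz

theorem isLinked_singleton (z : V) : IsLinked G {z} :=
  fun _ hT hne hTz => absurd ((subset_singleton_iff.1 hT).resolve_left hne.ne_empty) hTz

theorem IsLinked.union (hA : IsLinked G A) (hB : IsLinked G B) {a b : V} (ha : a ∈ A) (hb : b ∈ B)
    (hab : G.Adj a b) : IsLinked G (A ∪ B) := by
  refine isLinked_of_notMem a fun T hT hne haT => ?_
  have step : ∀ C ⊆ A ∪ B, IsLinked G C → (T ∩ C).Nonempty → T ∩ C ≠ C →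
      ∃ u ∈ T, ∃ v ∈ (A ∪ B) \ T, G.Adj u v := by
    intro C hC hlink hne hTC
    obtain ⟨u, hu, v, hv, huv⟩ := hlink (T ∩ C) inter_subset_right hne hTC
    simp only [mem_inter, mem_sdiff, not_and'] at hu hv
    exact ⟨u, hu.1, v, mem_sdiff.2 ⟨hC hv.1, hv.2 hv.1⟩, huv⟩
  by_cases hTA : (T ∩ A).Nonempty
  · exact step A subset_union_left hA hTA fun h => haT (mem_inter.1 (h.ge ha)).1
  · have hTB : T ⊆ B := fun u hu => (mem_union.1 (hT hu)).resolve_left fun h =>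
      hTA ⟨u, mem_inter.2 ⟨hu, h⟩⟩
    have hTB' : T ∩ B = T := inter_eq_left.2 hTB
    by_cases hTeq : T = B
    · exact ⟨b, hTeq ▸ hb, a, by simp [ha, haT], hab.symm⟩
    · exact step B subset_union_right hB (by rwa [hTB']) (by rwa [hTB'])

/-- A largest proper connected subset containing `z` misses just one vertex, since adding a
neighbour keeps it connected. -/
theorem IsLinked.exists_erase (hQ : IsLinked G Q) {z : V} (hz : z ∈ Q) (hcard : 2 ≤ #Q) :
    ∃ x ∈ Q, x ≠ z ∧ IsLinked G (Q.erase x) := by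
  classical
  have hne : {R ∈ Q.powerset | z ∈ R ∧ R ≠ Q ∧ IsLinked G R}.Nonempty := by
    refine ⟨{z}, ?_⟩
    simp only [mem_filter, mem_powerset, singleton_subset_iff, mem_singleton]
    refine ⟨hz, trivial, ?_, isLinked_singleton z⟩
    rintro rfl
    simp at hcard
  obtain ⟨R, hR, hmax⟩ := exists_max_image _ card hne
  simp only [mem_filter, mem_powerset] at hR hmax
  obtain ⟨hRQ, hzR, hne, hlink⟩ := hR
  obtain ⟨u, hu, v, hv, huv⟩ := hQ R hRQ ⟨z, hzR⟩ hne
  obtain ⟨hvQ, hvR⟩ := mem_sdiff.1 hv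
  have hins : insert v R = Q := by
    by_contra h
    have h1 : IsLinked G (insert v R) := by
      rw [← union_singleton]
      exact hlink.union (isLinked_singleton v) hu (mem_singleton_self v) huv
    have := hmax (insert v R) ⟨insert_subset hvQ hRQ, mem_insert_of_mem hzR, h, h1⟩
    rw [card_insert_of_notMem hvR] at this
    omega
  refine ⟨v, hvQ, by rintro rfl; exact hvR hzR, ?_⟩
  rwa [← hins, erase_insert hvR]

open scoped Classical in
/-- The vertices of `S` that have a neighbour in `P`. -/
noncomputable def attachments (G : SimpleGraph V) (S P : Finset V) : Finset V :=
  {s ∈ S | ∃ p ∈ P, G.Adj p s}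

theorem mem_attachments {s : V} : s ∈ attachments G S P ↔ s ∈ S ∧ ∃ p ∈ P, G.Adj p s := by
  simp [attachments]

/-- A minimal connected piece with two attachments acts as an ear. If deleting $z\in P$ cut off
$T\subseteq P$, then $P\setminus T$ would be a smaller connected piece with the same attachments. -/
theorem IsNonsep.union (hS : IsNonsep G S) (hdisj : Disjoint S P) (hP : IsLinked G P)
    (hatt : 2 ≤ #(attachments G S P))
    (hmin : ∀ P' ⊂ P, P'.Nonempty → IsLinked G P' → #(attachments G S P') ≤ 1) :
    IsNonsep G (S ∪ P) := by
  refine ⟨hS.1.trans (card_le_card subset_union_left), ?_, fun z hz => ?_⟩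
  · obtain ⟨s, hs⟩ := card_pos.1 (by omega : 0 < #(attachments G S P))
    obtain ⟨hsS, p, hp, hps⟩ := mem_attachments.1 hs
    exact hS.2.1.union hP hsS hp hps.symm
  rw [erase_union_distrib]
  by_cases hzS : z ∈ S
  · rw [erase_eq_of_notMem (disjoint_left.1 hdisj hzS)]
    obtain ⟨s, hs, hsz⟩ := exists_mem_ne hatt z
    obtain ⟨hsS, p, hp, hps⟩ := mem_attachments.1 hs
    exact (hS.2.2 z hzS).union hP (mem_erase.2 ⟨hsz, hsS⟩) hp hps.symm
  · have hzP : z ∈ P := (mem_union.1 hz).resolve_left hzS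
    rw [erase_eq_of_notMem hzS]
    obtain ⟨s₀, hs₀⟩ := card_pos.1 (by have := hS.1; omega : 0 < #S)
    refine isLinked_of_notMem s₀ fun T hT hne hsT => ?_
    by_cases hTS : (T ∩ S).Nonempty
    · obtain ⟨u, hu, v, hv, huv⟩ := hS.2.1 (T ∩ S) inter_subset_right hTS
        fun h => hsT (mem_inter.1 (h.ge hs₀)).1
      simp only [mem_inter, mem_sdiff, not_and'] at hu hv
      exact ⟨u, hu.1, v, mem_sdiff.2 ⟨mem_union_left _ hv.1, hv.2 hv.1⟩, huv⟩
    · have hTP : T ⊆ P.erase z := fun u hu => (mem_union.1 (hT hu)).resolve_left fun h =>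
        hTS ⟨u, mem_inter.2 ⟨hu, h⟩⟩
      by_contra! hcon
      have hzT : z ∉ T := fun h => by simpa using hTP h
      have hssub : P \ T ⊂ P := sdiff_ssubset (hTP.trans (erase_subset _ _)) hne
      have hlink : IsLinked G (P \ T) := by
        refine isLinked_of_notMem z fun A hA hAne hzA => ?_
        obtain ⟨u, hu, v, hv, huv⟩ := hP A (hA.trans sdiff_subset) hAne
          (by rintro rfl; exact hzA hzP)
        obtain ⟨hvP, hvA⟩ := mem_sdiff.1 hv
        obtain ⟨huP, huT⟩ := mem_sdiff.1 (hA hu)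
        refine ⟨u, hu, v, ?_, huv⟩
        simp only [mem_sdiff, hvP, hvA, true_and, not_false_eq_true, and_true]
        intro hvT
        refine hcon v hvT u (mem_sdiff.2 ⟨mem_union_right _ (mem_erase.2 ⟨?_, huP⟩), huT⟩) huv.symm
        rintro rfl
        exact hzA hu
      have hsub : attachments G S P ⊆ attachments G S (P \ T) := by
        intro s hs
        obtain ⟨hsS, p, hp, hps⟩ := mem_attachments.1 hs
        refine mem_attachments.2 ⟨hsS, p, mem_sdiff.2 ⟨hp, fun hpT => ?_⟩, hps⟩
        exact hcon p hpT s (mem_sdiff.2 ⟨mem_union_left _ hsS, fun h =>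
          hTS ⟨s, mem_inter.2 ⟨h, hsS⟩⟩⟩) hps
      have := hmin (P \ T) hssub ⟨z, mem_sdiff.2 ⟨hzP, hzT⟩⟩ hlink
      have := card_le_card hsub
      omega

theorem exists_isLinked_two_le_attachments (hU : IsNonsep G U) (hSU : S ⊆ U) (hS : 2 ≤ #S)
    (hne : (U \ S).Nonempty) :
    ∃ P ⊆ U \ S, P.Nonempty ∧ IsLinked G P ∧ 2 ≤ #(attachments G S P) := by
  classical
  have hfam : {P ∈ (U \ S).powerset | P.Nonempty ∧
      ∀ u ∈ P, ∀ v ∈ (U \ S) \ P, ¬ G.Adj u v}.Nonempty :=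
    -- The family consists of the nonempty unions of components of $U\setminus S$; a smallest member
    -- is a component.
    ⟨U \ S, mem_filter.2 ⟨mem_powerset_self _, hne, by simp only [sdiff_self, bot_eq_empty, notMem_empty]; tauto⟩⟩
  obtain ⟨P, hP, hmin⟩ := exists_min_image _ card hfam
  simp only [mem_filter, mem_powerset] at hP hmin
  obtain ⟨hPQ, hPne, hclosed⟩ := hP
  refine ⟨P, hPQ, hPne, fun A hA hAne hAP => ?_, ?_⟩
  · by_contra! hcon
    have h1 := hmin A ⟨hA.trans hPQ, hAne, fun u hu v hv hadj => by
      obtain ⟨hvQ, hvA⟩ := mem_sdiff.1 hv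
      by_cases hvP : v ∈ P
      · exact hcon u hu v (mem_sdiff.2 ⟨hvP, hvA⟩) hadj
      · exact hclosed u (hA hu) v (mem_sdiff.2 ⟨hvQ, hvP⟩) hadj⟩
    have h2 := card_lt_card (hA.ssubset_of_ne hAP)
    omega
  · have hPU : P ⊆ U := hPQ.trans sdiff_subset
    have hPS : ∀ s ∈ S, s ∉ P := fun s hs hp => (mem_sdiff.1 (hPQ hp)).2 hs
    have hout : ∀ u ∈ P, ∀ v ∈ U, v ∉ P → G.Adj u v → v ∈ attachments G S P := by
      intro u hu v hv hvP huv
      by_cases hvS : v ∈ S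
      · exact mem_attachments.2 ⟨hvS, u, hu, huv⟩
      · exact absurd huv (hclosed u hu v (by simp [hv, hvS, hvP]))
    obtain ⟨s₀, hs₀⟩ := card_pos.1 (by omega : 0 < #S)
    obtain ⟨u, hu, s, hs, hus⟩ := hU.2.1 P hPU hPne fun h => hPS s₀ hs₀ (h ▸ hSU hs₀)
    obtain ⟨hsU, hsP⟩ := mem_sdiff.1 hs
    -- Connectedness of $U$ gives one attachment `s`; connectedness of $U-s$ gives another.
    have hs1 := hout u hu s hsU hsP hus
    obtain ⟨t, ht, hts⟩ := exists_mem_ne hS s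
    obtain ⟨u', hu', s', hs', hus'⟩ := hU.2.2 s hsU P
      (fun p hp => mem_erase.2 ⟨by rintro rfl; exact hsP hp, hPU hp⟩) hPne
      fun h => hPS t ht (h ▸ mem_erase.2 ⟨hts, hSU ht⟩)
    obtain ⟨hs'U, hs'P⟩ := mem_sdiff.1 hs'
    have hs2 := hout u' hu' s' (mem_of_mem_erase hs'U) hs'P hus'
    exact one_lt_card.2 ⟨s, hs1, s', hs2, (ne_of_mem_erase hs'U).symm⟩

/-- A largest proper nonseparable subset `S` of a nonseparable set `U` with `2 ≤ #(U \ S)` has just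
two vertices with a neighbour outside, each of which has just one such neighbour. -/
theorem IsNonsep.exists_attached (hU : IsNonsep G U) (hSU : S ⊆ U) (hS : IsNonsep G S)
    (hmax : ∀ S' ⊂ U, IsNonsep G S' → #S' ≤ #S) (hcard : 2 ≤ #(U \ S)) :
    ∃ x ∈ U \ S, ∃ y ∈ U \ S, ∃ a ∈ S, ∃ b ∈ S, a ≠ b ∧ G.Adj x a ∧ G.Adj y b ∧
      (∀ u ∈ U \ S, G.Adj u a → u = x) ∧ (∀ u ∈ U \ S, G.Adj u b → u = y) ∧
      ∀ w ∈ S, w ≠ a → w ≠ b → ∀ u ∈ U \ S, ¬ G.Adj u w := by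
  classical
  obtain ⟨P₀, hP₀⟩ := exists_isLinked_two_le_attachments hU hSU hS.1 (card_pos.1 (by omega))
  have hfam : {P ∈ (U \ S).powerset | P.Nonempty ∧ IsLinked G P ∧
      2 ≤ #(attachments G S P)}.Nonempty := ⟨P₀, by simpa using hP₀⟩
  obtain ⟨P, hP, hmin⟩ := exists_min_image _ card hfam
  simp only [mem_filter, mem_powerset] at hP hmin
  obtain ⟨hPQ, hPne, hPlink, hPatt⟩ := hP
  have hdisj : Disjoint S P := disjoint_of_subset_right hPQ disjoint_sdiff
  have hmin' : ∀ P' ⊂ P, P'.Nonempty → IsLinked G P' → #(attachments G S P') ≤ 1 := by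
    intro P' hP' hne hlink
    by_contra! h
    have h1 := hmin P' ⟨hP'.subset.trans hPQ, hne, hlink, h⟩
    have h2 := card_lt_card hP'
    omega
  have hSP := hS.union hdisj hPlink hPatt hmin'
  -- By maximality of `S`, the minimal ear fills the whole complement.
  have hPeq : P = U \ S := by
    by_contra hne
    obtain ⟨v, hv, hvP⟩ := exists_of_ssubset (hPQ.ssubset_of_ne hne)
    obtain ⟨hvU, hvS⟩ := mem_sdiff.1 hv
    have h1 := hmax (S ∪ P) (ssubset_iff_of_subset
      (union_subset hSU (hPQ.trans sdiff_subset)) |>.2 ⟨v, hvU, by simp [hvS, hvP]⟩) hSP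
    rw [card_union_of_disjoint hdisj] at h1
    have := hPne.card_pos
    omega
  subst hPeq
  set Q := U \ S with hQ
  -- For a non-cut vertex $x$ of $Q$, both $\{x\}$ and $Q-x$ are smaller connected pieces with at
  -- most one attachment each. Together they have at least two, so each has exactly one. This is
  -- used below for two such vertices.
  have split : ∀ x ∈ Q, IsLinked G (Q.erase x) → ∃ a b, a ≠ b ∧ attachments G S {x} = {a} ∧
      attachments G S (Q.erase x) = {b} := by
    intro x hx hlink
    have hne : (Q.erase x).Nonempty := card_pos.1 (by rw [card_erase_of_mem hx]; omega)
    have h1 := hmin' (Q.erase x) (erase_ssubset hx) hne hlink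
    have h2 := hmin' {x} ((singleton_subset_iff.2 hx).ssubset_of_ne
      (by intro h; rw [← h] at hcard; simp at hcard)) (singleton_nonempty x) (isLinked_singleton x)
    have hunion : attachments G S Q = attachments G S {x} ∪ attachments G S (Q.erase x) := by
      ext s
      simp only [mem_union, mem_attachments, mem_singleton, exists_eq_left, mem_erase]
      constructor
      · rintro ⟨hs, p, hp, hps⟩
        by_cases hpx : p = x
        · exact Or.inl ⟨hs, hpx ▸ hps⟩
        · exact Or.inr ⟨hs, p, ⟨hpx, hp⟩, hps⟩
      · rintro (⟨hs, h⟩ | ⟨hs, p, ⟨-, hp⟩, h⟩)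
        · exact ⟨hs, x, hx, h⟩
        · exact ⟨hs, p, hp, h⟩
    have h3 := card_union_le (attachments G S {x}) (attachments G S (Q.erase x))
    rw [← hunion] at h3
    obtain ⟨a, ha⟩ := card_eq_one.1 (by omega : #(attachments G S {x}) = 1)
    obtain ⟨b, hb⟩ := card_eq_one.1 (by omega : #(attachments G S (Q.erase x)) = 1)
    refine ⟨a, b, ?_, ha, hb⟩
    rintro rfl
    rw [hunion, ha, hb] at hPatt
    simp at hPatt
  obtain ⟨q, hq⟩ := hPne
  obtain ⟨x, hx, -, hxlink⟩ := hPlink.exists_erase hq hcard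
  obtain ⟨y, hy, hyx, hylink⟩ := hPlink.exists_erase hx hcard
  obtain ⟨a, b, hab, hxa, hxb⟩ := split x hx hxlink
  obtain ⟨b', a', -, hyb, hya⟩ := split y hy hylink
  have ha : a ∈ S ∧ G.Adj x a := by
    simpa [mem_attachments] using (hxa ▸ mem_singleton_self a : a ∈ attachments G S {x})
  have hb' : b' ∈ S ∧ G.Adj y b' := by
    simpa [mem_attachments] using (hyb ▸ mem_singleton_self b' : b' ∈ attachments G S {y})
  obtain rfl : b' = b := by
    rw [← mem_singleton, ← hxb]
    exact mem_attachments.2 ⟨hb'.1, y, mem_erase.2 ⟨hyx, hy⟩, hb'.2⟩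
  obtain rfl : a = a' := by
    rw [← mem_singleton, ← hya]
    exact mem_attachments.2 ⟨ha.1, x, mem_erase.2 ⟨hyx.symm, hx⟩, ha.2⟩
  have key : ∀ u ∈ Q, ∀ w ∈ S, G.Adj u w → u ≠ x → w = b' := fun u hu w hw huw hux => by
    rw [← mem_singleton, ← hxb]
    exact mem_attachments.2 ⟨hw, u, mem_erase.2 ⟨hux, hu⟩, huw⟩
  have key' : ∀ u ∈ Q, ∀ w ∈ S, G.Adj u w → u ≠ y → w = a := fun u hu w hw huw huy => by
    rw [← mem_singleton, ← hya]
    exact mem_attachments.2 ⟨hw, u, mem_erase.2 ⟨huy, hu⟩, huw⟩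
  refine ⟨x, hx, y, hy, a, ha.1, b', hb'.1, hab, ha.2, hb'.2, fun u hu hua => ?_,
    fun u hu hub => ?_, fun w hw hwa hwb u hu huw => ?_⟩
  · by_contra h
    exact hab (key u hu a ha.1 hua h)
  · by_contra h
    exact hab (key' u hu b' hb'.1 hub h).symm
  · by_cases h : u = x
    · exact hwa (key' u hu w hw huw (by rw [h]; exact hyx.symm))
    · exact hwb (key u hu w hw huw h)

end

/-! ### Small nonseparable sets and the block theorem. -/

section

variable {V : Type*} [DecidableEq V] {κ : ℕ} {G : SimpleGraph V} {H : SimpleGraph (V × Fin κ)}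
  {f : V × Fin κ → ℕ} {S U Q : Finset V}

theorem IsCompleteOn.isNonsep (h : IsCompleteOn G S) (hS : 2 ≤ #S) : IsNonsep G S :=
  ⟨hS, h.isLinked, fun _ _ => (h.mono (erase_subset _ _)).isLinked⟩

theorem isNonsep_pair {u v : V} (h : G.Adj u v) : IsNonsep G {u, v} := by
  refine IsCompleteOn.isNonsep (fun a ha b hb hab => ?_) (card_pair h.ne).ge
  simp only [mem_insert, mem_singleton] at ha hb
  rcases ha with rfl | rfl <;> rcases hb with rfl | rfl
  · exact absurd rfl hab
  · exact h
  · exact h.symm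
  · exact absurd rfl hab

theorem IsNonsep.exists_adj_ne (hS : IsNonsep G S) (hcard : 3 ≤ #S) {v z : V} (hv : v ∈ S)
    (hz : z ∈ S) (hvz : v ≠ z) : ∃ u ∈ S, u ≠ z ∧ G.Adj v u := by
  have hne : ({v} : Finset V) ≠ S.erase z := by
    intro h
    have := card_erase_of_mem hz
    rw [← h, card_singleton] at this
    omega
  obtain ⟨v', hv', u, hu, huv⟩ := hS.2.2 z hz {v}
    (singleton_subset_iff.2 (mem_erase.2 ⟨hvz, hv⟩)) (singleton_nonempty v) hne
  rw [mem_singleton] at hv'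
  subst hv'
  simp only [mem_sdiff, mem_erase] at hu
  exact ⟨u, hu.1.2, hu.1.1, huv⟩

theorem IsNonsep.exists_adj (hS : IsNonsep G S) {v : V} (hv : v ∈ S) : ∃ u ∈ S, G.Adj v u := by
  obtain ⟨v', hv', u, hu, huv⟩ := hS.2.1 {v} (singleton_subset_iff.2 hv) (singleton_nonempty v)
    (by intro h; have := hS.1; rw [← h] at this; simp at this)
  rw [mem_singleton] at hv'
  subst hv'
  exact ⟨u, (mem_sdiff.1 hu).1, huv⟩

theorem IsNonsep.two_le_degIn (hS : IsNonsep G S) (hcard : 3 ≤ #S) {v : V} (hv : v ∈ S) :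
    2 ≤ degIn G S v := by
  obtain ⟨u, hu, huv⟩ := hS.exists_adj hv
  obtain ⟨w, hw, hwu, hwv⟩ := hS.exists_adj_ne hcard hv hu huv.ne
  exact one_lt_card.2 ⟨u, by simp [hu, huv], w, by simp [hw, hwv], hwu.symm⟩

theorem IsNonsep.isCompleteOn (hS : IsNonsep G S) (hcard : #S ≤ 3) : IsCompleteOn G S := by
  intro u hu v hv huv
  by_cases h : ∃ z ∈ S, z ≠ u ∧ z ≠ v
  · obtain ⟨z, hz, hzu, hzv⟩ := h
    have h3 : #({u, v, z} : Finset V) = 3 := card_eq_three.2 ⟨u, v, z, huv, hzu.symm, hzv.symm, rfl⟩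
    have hsub : {u, v, z} ⊆ S := by
      simp [insert_subset_iff, hu, hv, hz]
    have heq := eq_of_subset_of_card_le hsub (by omega)
    obtain ⟨w, hw, hwz, huw⟩ := hS.exists_adj_ne (heq ▸ h3.ge) hu hz hzu.symm
    rw [← heq] at hw
    simp only [mem_insert, mem_singleton] at hw
    rcases hw with rfl | rfl | rfl
    · exact absurd rfl huw.ne
    · exact huw
    · exact absurd rfl hwz
  · push Not at h
    obtain ⟨w, hw, huw⟩ := hS.exists_adj hu
    rwa [← h w hw huw.ne']

theorem degIn_eq_one {x v : V} (hx : x ∈ Q) (h : G.Adj x v) (honly : ∀ u ∈ Q, G.Adj u v → u = x) :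
    degIn G Q v = 1 := by
  unfold degIn
  rw [card_eq_one]
  refine ⟨x, ?_⟩
  ext u
  simp only [mem_filter, mem_singleton]
  constructor
  · exact fun hu => honly u hu.1 hu.2.symm
  · rintro rfl
    exact ⟨hx, h.symm⟩

/-- Colour `x` by `c` first and then the rest of `U \ S`. -/
theorem IsBadOn.exists_residual (hH : IsCover G H) (hbad : IsBadOn H f U) (hU : IsNonsep G U)
    (hf : IsLarge G f U) (hSU : S ⊆ U) {x a : V} (hx : x ∈ U \ S) (ha : a ∈ S)
    (honly : ∀ u ∈ U \ S, G.Adj u a → u = x) {c : Fin κ} (hc : 0 < f (x, c)) :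
    ∃ g, IsBadOn H g S ∧ IsLarge G g S ∧
      (∀ w ∈ S, (∀ u ∈ U \ S, ¬ G.Adj u w) → ∀ q, g (w, q) = f (w, q)) ∧
      (∀ q, ¬ H.Adj (a, q) (x, c) → g (a, q) = f (a, q)) ∧
      ∀ q, H.Adj (a, q) (x, c) → g (a, q) = f (a, q) - 1 := by
  have hκ : 0 < κ := c.pos
  obtain ⟨hxU, hxS⟩ := mem_sdiff.1 hx
  have hb1 := hbad.residual_erase (φ := fun _ => c) hxU hc
  have hf1 := hf.residual_erase hH hxU (fun _ => c)
  have hsplit : U.erase x = S ∪ (U \ S).erase x := by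
    ext v
    simp only [mem_erase, mem_union, mem_sdiff]
    constructor
    · tauto
    · rintro (h | h)
      · exact ⟨fun hvx => hxS (hvx ▸ h), hSU h⟩
      · exact ⟨h.1, h.2.1⟩
  have hdisj : Disjoint S ((U \ S).erase x) :=
    disjoint_of_subset_right (erase_subset _ _) disjoint_sdiff
  have haU : a ∈ U.erase x := hsplit ▸ mem_union_left _ ha
  have hsub : (U \ S).erase x ⊆ U.erase x := erase_subset_erase x sdiff_subset
  -- As $U-x$ is connected and contains `S`, the remaining outside vertices can be coloured greedily
  -- towards `S`.
  obtain ⟨φ, hφ⟩ := exists_isGoodOn (Q := (U \ S).erase x) (U := U.erase x)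
    (f := residual H f (fun _ => c) {x}) hH hκ
    (fun T hT hne => hU.2.2 x hxU T (hT.trans hsub) hne (by
      rintro rfl
      exact disjoint_left.1 hdisj ha (hT haU)))
    hsub (fun v hv => hf1 v (hsub hv))
  rw [hsplit] at hb1 hf1
  have hga : ∀ q, residual H (residual H f (fun _ => c) {x}) φ ((U \ S).erase x) (a, q) =
      residual H f (fun _ => c) {x} (a, q) := by
    intro q
    unfold residual
    rw [hits_eq_zero hH (S := (U \ S).erase x) (fun u hu h => ne_of_mem_erase hu
      (honly u (mem_of_mem_erase hu) h.symm))]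
    rfl
  refine ⟨_, hb1.residual_left hdisj hφ, IsLarge.residual_left hH (fun v hv => hf1 v (mem_union_left _ hv)) hdisj φ,
    fun w _ hw q => ?_, fun q hq => ?_, fun q hq => ?_⟩
  · unfold residual
    rw [hits_eq_zero hH (S := (U \ S).erase x) (fun u hu h => hw u (mem_of_mem_erase hu) h.symm),
      hits_eq_zero hH (S := {x}) (fun u hu h => hw x hx (mem_singleton.1 hu ▸ h.symm))]
    rfl
  · rw [hga, residual_of_not_adj hq]
  · rw [hga, residual_of_adj hq]

/-- Every vertex of `S` has exactly two neighbours in `S`. -/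
def IsTwoRegularOn (G : SimpleGraph V) (S : Finset V) : Prop :=
  ∀ v ∈ S, degIn G S v = 2

theorem add_le_sum_of_ne (g : Fin κ → ℕ) {p q : Fin κ} (h : p ≠ q) : g p + g q ≤ ∑ i, g i := by
  rw [← sum_pair h]
  exact sum_le_sum_of_subset (subset_univ _)

/-- Two colours of positive value at `x`, and their partners at a neighbour `a`. -/
theorem IsBadOn.exists_two_colours (hH : IsCover G H) (hbad : IsBadOn H f U) (hU : IsNonsep G U)
    (hf : IsLarge G f U) {x a : V} (hx : x ∈ U) (ha : a ∈ U) (hxa : G.Adj x a)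
    (hsupp : 2 ≤ suppCard f x) :
    ∃ c d c' d', 0 < f (x, c) ∧ 0 < f (x, d) ∧ 0 < f (a, c') ∧ 0 < f (a, d') ∧ c' ≠ d' ∧
      H.Adj (a, c') (x, c) ∧ H.Adj (a, d') (x, d) ∧ ¬ H.Adj (a, d') (x, c) ∧
      ¬ H.Adj (a, c') (x, d) := by
  obtain ⟨c, hc, d, hd, hcd⟩ := one_lt_card.1 hsupp
  simp only [mem_filter, mem_univ, true_and] at hc hd
  obtain ⟨c', hc', hc0⟩ := hbad.exists_adj hH hU.2.1 hf hx (hU.2.2 x hx) ha hxa.symm hc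
  obtain ⟨d', hd', hd0⟩ := hbad.exists_adj hH hU.2.1 hf hx (hU.2.2 x hx) ha hxa.symm hd
  have h1 : ∀ e, H.Adj (a, e) (x, c) → H.Adj (a, e) (x, d) → False := fun e h h' => by
    have := hH.matching h h' rfl
    simp [hcd] at this
  exact ⟨c, d, c', d', hc, hd, hc0, hd0, by rintro rfl; exact h1 _ hc' hd', hc', hd',
    fun h => h1 _ h hd', fun h => h1 _ hc' h⟩

/-- The alternatives of the block theorem for `S`, applied to two colourings of `U \ S` with
different effect on `a`. -/
theorem IsBadOn.alternatives (hH : IsCover G H) (hbad : IsBadOn H f U) (hU : IsNonsep G U)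
    (hf : IsLarge G f U) (hS : IsNonsep G S) (hSU : S ⊆ U) {x a : V} (hx : x ∈ U \ S)
    (ha : a ∈ S) (hxa : G.Adj x a) (honly : ∀ u ∈ U \ S, G.Adj u a → u = x)
    (hsupp : ∀ v ∈ U, 2 ≤ suppCard f v)
    (ih : ∀ g, IsBadOn H g S → IsLarge G g S → IsCompleteOn G S ∨ IsTwoRegularOn G S ∨
      ∀ v ∈ S, ∃ q, degIn G S v ≤ g (v, q)) :
    IsCompleteOn G S ∨ IsTwoRegularOn G S ∨ degIn G S a ≤ 1 := by
  have hxU := (mem_sdiff.1 hx).1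
  obtain ⟨c, d, c', d', hc, hd, hc0, hd0, hcd, hcc, hdd, hdc, hcd'⟩ :=
    hbad.exists_two_colours hH hU hf hxU (hSU ha) hxa (hsupp x hxU)
  have hκ : 0 < κ := c.pos
  -- colouring `x` by `c` keeps the value at `e'`, so the whole degree sits there
  have key : ∀ c e' c', 0 < f (x, c) → 0 < f (a, e') → c' ≠ e' → ¬ H.Adj (a, e') (x, c) →
      H.Adj (a, c') (x, c) → (IsCompleteOn G S ∨ IsTwoRegularOn G S) ∨
      f (a, e') = degIn G S a ∧ f (a, c') ≤ 1 := by
    intro c e' c' hc he0 hne hnadj hadj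
    obtain ⟨g, hgbad, hgf, -, hg1, hg2⟩ := hbad.exists_residual hH hU hf hSU hx ha honly hc
    rcases ih g hgbad hgf with h | h | h
    · exact Or.inl (Or.inl h)
    · exact Or.inl (Or.inr h)
    obtain ⟨q, hq⟩ := h a ha
    have hsum := hgbad.sum_eq hH hκ hS.2.1 hgf ha
    have he := hg1 e' hnadj
    -- The value at `q` already exhausts the sum $\deg_S(a)$, while `e'` keeps positive value.
    have hqe : q = e' := by
      by_contra hqe
      have := add_le_sum_of_ne (fun i => g (a, i)) hqe
      omega
    subst hqe
    have := add_le_sum_of_ne (fun i => g (a, i)) hne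
    have hc2 := hg2 c' hadj
    exact Or.inr ⟨by omega, by omega⟩
  rcases key c d' c' hc hd0 hcd hdc hcc with h | ⟨h1, h2⟩
  · tauto
  rcases key d c' d' hd hc0 hcd.symm hcd' hdd with h | ⟨h3, h4⟩
  · tauto
  exact Or.inr (Or.inr (by omega))

/-- The values at $w$ do not depend on how $x$ is coloured. If $S$ is complete, they determine the
matched values at $a$, which do change. If $S$ is 2-regular, the number of positive colours at $a$
must survive, so two colours at $a$ have value at least $2$, although $\deg_U(a)=3$. -/
theorem IsBadOn.false_of_no_neighbour (hH : IsCover G H) (hbad : IsBadOn H f U)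
    (hU : IsNonsep G U) (hf : IsLarge G f U) (hS : IsNonsep G S) (hSU : S ⊆ U) {x a w : V}
    (hx : x ∈ U \ S) (ha : a ∈ S) (hxa : G.Adj x a) (honly : ∀ u ∈ U \ S, G.Adj u a → u = x)
    (hsupp : ∀ v ∈ U, 2 ≤ suppCard f v) (hw : w ∈ S) (hwQ : ∀ u ∈ U \ S, ¬ G.Adj u w)
    (halt : IsCompleteOn G S ∨ IsTwoRegularOn G S) : False := by
  have hxU := (mem_sdiff.1 hx).1
  obtain ⟨c, d, c', d', hc, hd, hc0, hd0, hcd, hcc, hdd, hdc, hcd'⟩ :=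
    hbad.exists_two_colours hH hU hf hxU (hSU ha) hxa (hsupp x hxU)
  have hκ : 0 < κ := c.pos
  have haw : a ≠ w := by
    rintro rfl
    exact hwQ x hx hxa
  rcases halt with hcomp | hreg
  · obtain ⟨g, hgbad, hgf, hgw, -, hg2⟩ := hbad.exists_residual hH hU hf hSU hx ha honly hc
    obtain ⟨g', hgbad', hgf', hgw', hg1', -⟩ := hbad.exists_residual hH hU hf hSU hx ha honly hd
    have h1 := hg1' c' hcd'
    have h2 := hg2 c' hcc
    obtain ⟨q, hq, hq0⟩ := hgbad'.exists_adj hH hS.2.1 hgf' ha (hS.2.2 a ha) hw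
      (hcomp w hw a ha haw.symm) (c := c') (by omega)
    have h3 := hgbad'.eq_of_isCompleteOn hH hcomp hgf' hw ha hq hq0
    have h4 := hgw w hw hwQ q
    have h5 := hgw' w hw hwQ q
    have h6 := hgbad.eq_of_isCompleteOn hH hcomp hgf hw ha hq (by omega)
    omega
  · have key : ∀ c c', 0 < f (x, c) → 0 < f (a, c') → H.Adj (a, c') (x, c) → 2 ≤ f (a, c') := by
      intro c c' hc hc0 hcc
      by_contra! hlt
      obtain ⟨g, hgbad, hgf, hgw, hg1, hg2⟩ := hbad.exists_residual hH hU hf hSU hx ha honly hc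
      have h1 : suppCard g a = suppCard f a := by
        rw [hgbad.suppCard_eq hH hS hgf ha hw, hbad.suppCard_eq hH hU hf (hSU ha) (hSU hw)]
        simp only [suppCard, hgw w hw hwQ]
      have h2 : suppCard g a < suppCard f a := by
        refine card_lt_card ((ssubset_iff_of_subset fun q hq => ?_).2 ⟨c', by simpa using hc0, ?_⟩)
        · simp only [mem_filter, mem_univ, true_and] at hq ⊢
          by_cases h : H.Adj (a, q) (x, c)
          · have := hg2 q h
            omega
          · have := hg1 q h
            omega
        · have := hg2 c' hcc
          simp only [mem_filter, mem_univ, true_and]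
          omega
      omega
    have h1 := key c c' hc hc0 hcc
    have h2 := key d d' hd hd0 hdd
    have h3 := hbad.sum_eq hH hκ hU.2.1 hf (hSU ha)
    have h4 := add_le_sum_of_ne (fun i => f (a, i)) hcd
    have h5 := degIn_union (G := G) (disjoint_sdiff : Disjoint S (U \ S)) a
    rw [union_sdiff_of_subset hSU, degIn_eq_one hx hxa honly, hreg a ha] at h5
    omega

/-- The block theorem: a nonseparable set without strictly degenerate transversal, on which the
value sums are at least the degrees, is complete, 2-regular, or has all degrees bounded by the
maximum values. -/
theorem IsBadOn.trichotomy (hH : IsCover G H) (hκ : 0 < κ) (hbad : IsBadOn H f U)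
    (hU : IsNonsep G U) (hf : IsLarge G f U) :
    IsCompleteOn G U ∨ IsTwoRegularOn G U ∨ ∀ v ∈ U, ∃ q, degIn G U v ≤ f (v, q) := by
  classical
  induction hn : #U using Nat.strong_induction_on generalizing U f with
  | _ n ih =>
  subst hn
  by_cases hcomp : IsCompleteOn G U
  · exact Or.inl hcomp
  by_cases hmono : ∀ v ∈ U, ∃ q, degIn G U v ≤ f (v, q)
  · exact Or.inr (Or.inr hmono)
  refine Or.inr (Or.inl ?_)
  have hU4 : 4 ≤ #U := by
    by_contra! h
    exact hcomp (hU.isCompleteOn (by omega))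
  -- A single positive colour at `v₀` would carry the whole sum, that is the degree. The number of
  -- positive colours is constant on `U`.
  have hsupp : ∀ v ∈ U, 2 ≤ suppCard f v := by
    push Not at hmono
    obtain ⟨v₀, hv₀, hlt⟩ := hmono
    intro v hv
    rw [hbad.suppCard_eq hH hU hf hv hv₀]
    by_contra! h
    have hsum := hbad.sum_eq hH hκ hU.2.1 hf hv₀
    have hdeg := hU.two_le_degIn (by omega) hv₀
    obtain ⟨q, -, hq⟩ := exists_ne_zero_of_sum_ne_zero (by omega : ∑ q, f (v₀, q) ≠ 0)
    have h1 : ∑ q, f (v₀, q) = f (v₀, q) := by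
      refine sum_eq_single q (fun p _ hpq => ?_) (by simp)
      by_contra hp
      exact hpq (card_le_one.1 (Nat.lt_succ_iff.1 h) p (by simpa using Nat.pos_of_ne_zero hp) q
        (by simpa using Nat.pos_of_ne_zero hq))
    have := hlt q
    omega
  have alt : ∀ S, IsNonsep G S → S ⊂ U → ∀ x ∈ U \ S, ∀ a ∈ S, G.Adj x a →
      (∀ u ∈ U \ S, G.Adj u a → u = x) →
      IsCompleteOn G S ∨ IsTwoRegularOn G S ∨ degIn G S a ≤ 1 := fun S hS hSU x hx a ha hxa honly =>
    hbad.alternatives hH hU hf hS hSU.subset hx ha hxa honly hsupp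
      fun g hg hgf => ih _ (card_lt_card hSU) hg hS hgf rfl
  have pair_ssubset : ∀ u ∈ U, ∀ v ∈ U, {u, v} ⊂ U := fun u hu v hv =>
    (insert_subset hu (singleton_subset_iff.2 hv)).ssubset_of_ne fun h => by
      have := card_le_two (a := u) (b := v)
      rw [h] at this
      omega
  have hfam : {S ∈ U.ssubsets | IsNonsep G S}.Nonempty := by
    obtain ⟨u, hu⟩ := card_pos.1 (by omega : 0 < #U)
    obtain ⟨v, hv, huv⟩ := hU.exists_adj hu
    exact ⟨{u, v}, mem_filter.2 ⟨mem_ssubsets.2 (pair_ssubset u hu v hv), isNonsep_pair huv⟩⟩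
  obtain ⟨S, hSmem, hSmax⟩ := exists_max_image _ card hfam
  simp only [mem_filter, mem_ssubsets] at hSmem hSmax
  obtain ⟨hSU, hS⟩ := hSmem
  have hSmax' : ∀ S' ⊂ U, IsNonsep G S' → #S' ≤ #S := fun S' h h' => hSmax S' ⟨h, h'⟩
  have hQcard := card_sdiff_add_card_eq_card hSU.subset
  have hltcard := card_lt_card hSU
  by_cases hQ : 2 ≤ #(U \ S)
  -- Here every edge is a largest proper nonseparable set, so each of its ends has exactly one
  -- neighbour outside it.
  · by_cases hS2 : #S = 2
    · intro v hv
      obtain ⟨u, hu, hvu⟩ := hU.exists_adj hv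
      have hsub := pair_ssubset v hv u hu
      have h2 := card_pair hvu.ne
      have hcard := card_sdiff_add_card_eq_card hsub.subset
      have hdeg : ∀ a ∈ ({v, u} : Finset V), degIn G {v, u} a = 1 := by
        intro a ha
        rcases mem_insert.1 ha with rfl | ha
        · exact degIn_eq_one (x := u) (by simp) hvu.symm (by
            intro w hw hwv
            simpa [hwv.ne] using hw)
        · rw [mem_singleton] at ha
          subst ha
          exact degIn_eq_one (x := v) (by simp) hvu (by
            intro w hw hwv
            simpa [hwv.ne] using hw)
      obtain ⟨x, hx, y, hy, a, ha, b, hb, hab, hxa, hyb, hxo, hyo, -⟩ :=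
        hU.exists_attached hsub.subset (isNonsep_pair hvu)
          (fun S' h h' => by rw [h2, ← hS2]; exact hSmax' S' h h') (by omega)
      have hsum := degIn_union (G := G) (disjoint_sdiff : Disjoint {v, u} (U \ {v, u})) v
      rw [union_sdiff_of_subset hsub.subset, hdeg v (by simp)] at hsum
      have hvab : v = a ∨ v = b := by
        simp only [mem_insert, mem_singleton] at ha hb
        rcases ha with rfl | rfl
        · exact Or.inl rfl
        · rcases hb with rfl | rfl
          · exact Or.inr rfl
          · exact absurd rfl hab
      rcases hvab with rfl | rfl
      · rw [hsum, degIn_eq_one hx hxa hxo]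
      · rw [hsum, degIn_eq_one hy hyb hyo]
    · exfalso
      have hS3 : 3 ≤ #S := by
        have := hS.1
        omega
      obtain ⟨x, hx, y, hy, a, ha, b, hb, hab, hxa, hyb, hxo, hyo, hno⟩ :=
        hU.exists_attached hSU.subset hS hSmax' hQ
      obtain ⟨w, hw, hwab⟩ := exists_mem_notMem_of_card_lt_card
        (lt_of_le_of_lt (card_le_two (a := a) (b := b)) (by omega : 2 < #S))
      simp only [mem_insert, mem_singleton, not_or] at hwab
      have hdeg := hS.two_le_degIn hS3 ha
      refine hbad.false_of_no_neighbour hH hU hf hS hSU.subset hx ha hxa hxo hsupp hw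
        (hno w hw hwab.1 hwab.2) ?_
      rcases alt S hS hSU x hx a ha hxa hxo with h | h | h
      · exact Or.inl h
      · exact Or.inr h
      · omega
  · exfalso
    obtain ⟨x, hQx⟩ := card_eq_one.1 (by omega : #(U \ S) = 1)
    rw [hQx, card_singleton] at hQcard
    have hx : x ∈ U \ S := by simp [hQx]
    obtain ⟨hxU, hxS⟩ := mem_sdiff.1 hx
    have honly : ∀ a, ∀ u ∈ U \ S, G.Adj u a → u = x := fun a u hu _ => by
      simpa [hQx] using hu
    have hUS : ∀ v ∈ U, v ≠ x → v ∈ S := fun v hv hvx => by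
      by_contra h
      exact hvx (by simpa [hQx] using mem_sdiff.2 ⟨hv, h⟩)
    obtain ⟨a, haU, hxa⟩ := hU.exists_adj hxU
    have ha := hUS a haU hxa.ne'
    have hdeg := hS.two_le_degIn (by omega) ha
    have halt : IsCompleteOn G S ∨ IsTwoRegularOn G S := by
      rcases alt S hS hSU x hx a ha hxa (honly a) with h | h | h
      · exact Or.inl h
      · exact Or.inr h
      · omega
    -- From here $U$ is a wheel with hub `x`: the rim `S` is 2-regular, and not complete because $U$
    -- is not.
    have hall : ∀ w ∈ S, G.Adj x w := by
      by_contra! hcon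
      obtain ⟨w, hw, hxw⟩ := hcon
      exact hbad.false_of_no_neighbour hH hU hf hS hSU.subset hx ha hxa (honly a) hsupp hw
        (fun u hu => by rw [hQx, mem_singleton] at hu; rwa [hu]) halt
    have hnc : ¬ IsCompleteOn G S := by
      intro h
      refine hcomp fun u hu v hv huv => ?_
      by_cases hux : u = x
      · subst hux
        exact hall v (hUS v hv huv.symm)
      · by_cases hvx : v = x
        · subst hvx
          exact (hall u (hUS u hu hux)).symm
        · exact h u (hUS u hu hux) v (hUS v hv hvx) huv
    have hreg := halt.resolve_left hnc
    unfold IsCompleteOn at hnc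
    push Not at hnc
    obtain ⟨u, hu, w, hw, huw, hnadj⟩ := hnc
    have hS4 : 4 ≤ #S := by
      have h1 : degIn G S u ≤ #(S \ {u, w}) := by
        refine card_le_card fun z hz => ?_
        simp only [mem_filter] at hz
        simp only [mem_sdiff, mem_insert, mem_singleton, not_or]
        refine ⟨hz.1, hz.2.ne', ?_⟩
        rintro rfl
        exact hnadj hz.2
      have h2 := card_sdiff_add_card_eq_card
        (insert_subset hu (singleton_subset_iff.2 hw) : {u, w} ⊆ S)
      rw [card_pair huw] at h2
      have := hreg u hu
      omega
    obtain ⟨r, hr, hruw⟩ := exists_mem_notMem_of_card_lt_card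
      (lt_of_le_of_lt (card_le_two (a := u) (b := w)) (by omega : 2 < #S))
    simp only [mem_insert, mem_singleton, not_or] at hruw
    have hrU := hSU.subset hr
    have hrx : r ≠ x := by
      rintro rfl
      exact hxS hr
    have hxS' : x ∈ U.erase r := mem_erase.2 ⟨hrx.symm, hxU⟩
    have hQ' : U \ U.erase r = {r} := sdiff_erase_self hrU
    -- The rim minus `r` is connected, and the hub joins everything else. In this smaller set the
    -- hub has degree at least three and `u`, `w` are nonadjacent, so every alternative fails with
    -- `x` as attachment of `r`.
    have hnonsep : IsNonsep G (U.erase r) := by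
      refine ⟨by rw [card_erase_of_mem hrU]; omega, hU.2.2 r hrU, fun z hz => ?_⟩
      by_cases hzx : z = x
      · subst hzx
        have : (U.erase r).erase z = S.erase r := by
          ext v
          simp only [mem_erase]
          constructor
          · rintro ⟨h1, h2, h3⟩
            exact ⟨h2, hUS v h3 h1⟩
          · rintro ⟨h1, h2⟩
            exact ⟨fun h => hxS (h ▸ h2), h1, hSU.subset h2⟩
        rw [this]
        exact hS.2.2 r hr
      · refine isLinked_of_notMem x fun T hT hne hxT => ?_
        obtain ⟨t, ht⟩ := hne
        have htU := mem_of_mem_erase (mem_of_mem_erase (hT ht))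
        exact ⟨t, ht, x, mem_sdiff.2 ⟨mem_erase.2 ⟨Ne.symm hzx, hxS'⟩, hxT⟩,
          (hall t (hUS t htU (by rintro rfl; exact hxT ht))).symm⟩
    have hdegx : 3 ≤ degIn G (U.erase r) x := by
      have h1 : #(S.erase r) ≤ degIn G (U.erase r) x := by
        refine card_le_card fun z hz => ?_
        obtain ⟨hzr, hzS⟩ := mem_erase.1 hz
        simp [hzr, hSU.subset hzS, hall z hzS]
      rw [card_erase_of_mem hr] at h1
      omega
    rcases alt (U.erase r) hnonsep (erase_ssubset hrU) r (by simp [hQ']) x hxS' (hall r hr).symm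
      (fun v hv _ => by simpa [hQ'] using hv) with h | h | h
    · exact hnadj (h u (mem_erase.2 ⟨Ne.symm hruw.1, hSU.subset hu⟩) w
        (mem_erase.2 ⟨Ne.symm hruw.2, hSU.subset hw⟩) huw)
    · have := h x hxS'
      omega
    · omega

end

/-! ### Translation to Mathlib graphs: cycles and 2-connectedness. -/

theorem isCycleGraph_of_degree_eq_two {W : Type*} [Fintype W] {K : SimpleGraph W}
    [DecidableRel K.Adj] (hK : K.Connected) (hdeg : ∀ v, K.degree v = 2) : IsCycleGraph K := by
  classical
  have hnt : Nontrivial W := by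
    obtain ⟨v⟩ := hK.nonempty
    obtain ⟨u, hu⟩ := (K.degree_pos_iff_exists_adj v).1 (by rw [hdeg]; omega)
    exact ⟨v, u, hu.ne⟩
  -- A nontrivial tree has a leaf.
  have hcyc : ¬ K.IsAcyclic := by
    intro h
    obtain ⟨v, hv⟩ := SimpleGraph.IsTree.exists_vert_degree_one_of_nontrivial
      (⟨hK, h⟩ : K.IsTree)
    rw [hdeg] at hv
    omega
  rw [SimpleGraph.isAcyclic_iff_free_cycleGraph] at hcyc
  push Not at hcyc
  obtain ⟨n, hn, ⟨c⟩⟩ := hcyc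
  obtain ⟨m, rfl⟩ := Nat.exists_eq_add_of_le' hn
  have hinj : Function.Injective c := c.injective
  -- The cycle already uses both neighbours of each of its vertices, so no edge leaves it, and it
  -- spans by connectedness.
  have hnb : ∀ i, K.neighborFinset (c i) =
      ((SimpleGraph.cycleGraph (m + 3)).neighborFinset i).image c := by
    intro i
    refine (eq_of_subset_of_card_le ?_ ?_).symm
    · intro w hw
      obtain ⟨j, hj, rfl⟩ := mem_image.1 hw
      rw [SimpleGraph.mem_neighborFinset] at hj ⊢
      exact c.toHom.map_adj hj
    · rw [card_image_of_injective _ hinj, SimpleGraph.card_neighborFinset_eq_degree,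
        SimpleGraph.card_neighborFinset_eq_degree, hdeg,
        SimpleGraph.cycleGraph_degree_three_le]
  have hsurj : Function.Surjective c := by
    intro w
    by_contra hw
    obtain ⟨p⟩ := hK.preconnected (c 0) w
    obtain ⟨d, -, hd1, hd2⟩ := p.exists_boundary_dart (Set.range c) ⟨0, rfl⟩ (by simpa using hw)
    obtain ⟨i, hi⟩ := hd1
    have := hnb i ▸ (SimpleGraph.mem_neighborFinset _ _ _).2 (hi ▸ d.adj)
    obtain ⟨j, -, hj⟩ := mem_image.1 this
    exact hd2 ⟨j, hj⟩
  refine ⟨m + 3, hn, ⟨(RelIso.mk (Equiv.ofBijective c ⟨hinj, hsurj⟩) ?_ :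
    SimpleGraph.cycleGraph (m + 3) ≃g K).symm⟩⟩
  intro i j
  change K.Adj (c i) (c j) ↔ _
  constructor
  · intro h
    have := hnb i ▸ (SimpleGraph.mem_neighborFinset _ _ _).2 h
    obtain ⟨k, hk, hkj⟩ := mem_image.1 this
    rw [hinj hkj] at hk
    simpa using hk
  · exact c.toHom.map_adj

theorem isLinked_of_preconnected {V W : Type*} [DecidableEq V] {G : SimpleGraph V}
    {K : SimpleGraph W} (hK : K.Preconnected) (i : W → V)
    (hi : ∀ a b, K.Adj a b → G.Adj (i a) (i b)) {S : Finset V} (hS : ∀ v, v ∈ S ↔ ∃ a, i a = v) :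
    IsLinked G S := by
  rintro T hT ⟨u, hu⟩ hne
  obtain ⟨v, hv, hvT⟩ := exists_of_ssubset (hT.ssubset_of_ne hne)
  obtain ⟨a, rfl⟩ := (hS u).1 (hT hu)
  obtain ⟨b, rfl⟩ := (hS v).1 hv
  obtain ⟨p⟩ := hK a b
  obtain ⟨d, -, hd1, hd2⟩ := p.exists_boundary_dart {w | i w ∈ T} hu hvT
  exact ⟨i d.fst, hd1, i d.snd, mem_sdiff.2 ⟨(hS _).2 ⟨_, rfl⟩, hd2⟩, hi _ _ d.adj⟩

theorem IsTwoConnected.isNonsep {V : Type*} [Finite V] [DecidableEq V] {G : SimpleGraph V}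
    {F : G.Subgraph} (hF : IsTwoConnected F.coe) {S : Finset V} (hS : ∀ v, v ∈ S ↔ v ∈ F.verts) :
    IsNonsep G S := by
  obtain ⟨hcard, hconn, hdel⟩ := hF
  refine ⟨?_, ?_, fun x hx => ?_⟩
  · have : F.verts = (S : Set V) := by
      ext v
      simp [hS]
    rw [this, Nat.card_eq_card_toFinset, toFinset_coe] at hcard
    omega
  · exact isLinked_of_preconnected hconn.preconnected Subtype.val (fun a b h => h.adj_sub)
      (fun v => by simp [hS])
  · refine isLinked_of_preconnected (hdel ⟨x, (hS x).1 hx⟩).preconnected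
      (fun a => (a : F.verts).val) (fun a b h => ?_) (fun v => ?_)
    · rw [SimpleGraph.comap_adj] at h
      exact h.adj_sub
    · simp only [mem_erase, hS]
      constructor
      · rintro ⟨h1, h2⟩
        exact ⟨⟨⟨v, h2⟩, by simpa using h1⟩, rfl⟩
      · rintro ⟨⟨⟨a, ha⟩, hax⟩, rfl⟩
        exact ⟨by simpa using hax, ha⟩

/-! ### Transversals versus colourings, and the main theorem. -/

section

variable {V : Type*} [Fintype V] {κ : ℕ} {G : SimpleGraph V} {H : SimpleGraph (V × Fin κ)}
  {f : V × Fin κ → ℕ}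

theorem exists_isGoodOn_of_hasTransversal (hκ : 0 < κ) {X : Set V}
    (h : HasStrictlyDegenerateTransversalOn H f X) {S : Finset V} (hS : ∀ v ∈ S, v ∈ X) :
    ∃ φ, IsGoodOn H f S φ := by
  classical
  obtain ⟨R, ⟨-, hR⟩, hdeg⟩ := h
  have hex : ∀ v, ∃ q : Fin κ, v ∈ X → (v, q) ∈ R := by
    intro v
    by_cases hv : v ∈ X
    · obtain ⟨⟨w, q⟩, hx, hw⟩ := Set.nonempty_of_ncard_ne_zero (by rw [hR v hv]; omega :
        (R ∩ coverFiber κ v).ncard ≠ 0)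
      obtain rfl : w = v := hw
      exact ⟨q, fun _ => hx⟩
    · exact ⟨⟨0, hκ⟩, fun h => absurd h hv⟩
  choose φ hφ using hex
  refine ⟨φ, fun T hT hne => ?_⟩
  obtain ⟨t, ht⟩ := hne
  have hmem : ∀ u ∈ T, (u, φ u) ∈ R := fun u hu => hφ u (hS u (hT hu))
  -- The subgraph induced by the chosen vertices over `T` realises `hits` as its degrees.
  obtain ⟨v, hv, hlt⟩ := hdeg ((⊤ : (H.induce R).Subgraph).induce
    {x | x.1.1 ∈ T ∧ x.1.2 = φ x.1.1}) ⟨⟨(t, φ t), hmem t ht⟩, ht, rfl⟩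
  obtain ⟨⟨⟨v, q⟩, hvR⟩, hvT, hq⟩ := v, hv
  simp only at hvT hq
  subst hq
  refine ⟨v, hvT, lt_of_le_of_lt ?_ hlt⟩
  unfold hits
  rw [← Set.ncard_coe_finset]
  refine (Set.ncard_le_ncard ?_ (Set.toFinite _)).trans
    (Set.ncard_image_le (f := fun x : R => x.1.1) (Set.toFinite _))
  intro u hu
  simp only [coe_filter, Set.mem_ofPred_eq] at hu
  exact ⟨⟨(u, φ u), hmem u hu.1⟩, by simp [hvT, hu.1, hu.2], rfl⟩

theorem IsGoodOn.hasTransversal {φ : V → Fin κ} (h : IsGoodOn H f univ φ) :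
    HasStrictlyDegenerateTransversalOn H f Set.univ := by
  classical
  refine ⟨{x | x.2 = φ x.1}, ⟨fun x _ => by simp [coverFiber], fun v _ => ?_⟩, ?_⟩
  · rw [Set.ncard_eq_one]
    refine ⟨(v, φ v), ?_⟩
    ext ⟨u, q⟩
    simp only [coverFiber, Set.mem_inter_iff, Set.mem_ofPred_eq, Set.mem_singleton_iff,
      Prod.mk.injEq]
    constructor
    · rintro ⟨rfl, rfl⟩
      exact ⟨rfl, rfl⟩
    · rintro ⟨rfl, rfl⟩
      exact ⟨rfl, rfl⟩
  · rintro Γ ⟨⟨⟨t, q⟩, hq⟩, ht⟩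
    obtain rfl : q = φ t := hq
    -- An arbitrary subgraph has degrees at most those of the induced subgraph on its vertices, so
    -- the base set of `Γ` suffices.
    obtain ⟨v, hv, hlt⟩ := h {u | (⟨(u, φ u), rfl⟩ : {x : V × Fin κ | x.2 = φ x.1}) ∈ Γ.verts}
      (subset_univ _) ⟨t, by simpa using ht⟩
    refine ⟨⟨(v, φ v), rfl⟩, by simpa using hv, lt_of_le_of_lt ?_ hlt⟩
    unfold hits
    rw [← Set.ncard_coe_finset]
    refine Set.ncard_le_ncard_of_injOn (fun x => x.1.1) ?_ ?_ (Set.toFinite _)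
    · rintro ⟨⟨u, q⟩, hq⟩ hadj
      obtain rfl : q = φ u := hq
      have hadj' : Γ.Adj _ _ := hadj
      simp only [coe_filter, Set.mem_ofPred_eq, mem_filter, mem_univ, true_and]
      exact ⟨hadj'.snd_mem, by simpa using hadj'.adj_sub⟩
    · rintro ⟨⟨u, q⟩, hq⟩ - ⟨⟨u', q'⟩, hq'⟩ - heq
      obtain rfl : q = φ u := hq
      obtain rfl : q' = φ u' := hq'
      simp only at heq
      subst heq
      rfl

theorem degIn_univ_eq_degree [DecidableRel G.Adj] (v : V) : degIn G univ v = G.degree v := by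
  unfold degIn
  rw [← SimpleGraph.card_neighborFinset_eq_degree]
  congr 1
  ext u
  simp

theorem degree_induce_eq_degIn {X : Set V} {S : Finset V} (hS : ∀ v, v ∈ S ↔ v ∈ X) (v : X)
    [Fintype ((G.induce X).neighborSet v)] : (G.induce X).degree v = degIn G S v := by
  unfold degIn
  rw [← SimpleGraph.card_neighborFinset_eq_degree, ← card_map (Function.Embedding.subtype (· ∈ X))]
  congr 1
  ext u
  simp [hS, and_comm]

end

end DegenerateCover

open DegenerateCover in
theorem mainTheorem5 {V : Type*} [Fintype V] (G : SimpleGraph V) [DecidableRel G.Adj]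
    (κ : ℕ) (hκ : 0 < κ) (H : SimpleGraph (V × Fin κ)) (hH : IsCover G H)
    (f : V × Fin κ → ℕ) (hmin : MinimalNonStrictlyDegenerate H f)
    (F : G.Subgraph) [DecidablePred (· ∈ F.verts)] (hF : IsTwoConnected F.coe)
    (hdeg : ∀ v ∈ F.verts, G.degree v ≤ ∑ q : Fin κ, f (v, q)) :
    IsCycleGraph (G.induce F.verts) ∨
      G.induce F.verts = ⊤ ∨
      ∀ v : F.verts, (G.induce F.verts).degree v ≤
        Finset.univ.sup (fun q : Fin κ => f (v.1, q)) := by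
  classical
  set S : Finset V := Finset.univ.filter (· ∈ F.verts) with hSdef
  have hS : ∀ v, v ∈ S ↔ v ∈ F.verts := fun v => by simp [hSdef]
  have hnonsep : IsNonsep G S := IsTwoConnected.isNonsep hF hS
  obtain ⟨v₀, hv₀⟩ := Finset.card_pos.1 (by have := hnonsep.1; omega : 0 < S.card)
  -- A transversal avoiding one fibre over `S` restricts to the complement of `S`.
  obtain ⟨φ, hφ⟩ := exists_isGoodOn_of_hasTransversal (S := Finset.univ \ S) hκ (hmin.2 v₀)
    (fun v hv => by
      rintro rfl
      exact (Finset.mem_sdiff.1 hv).2 hv₀)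
  have hunion : S ∪ (Finset.univ \ S) = Finset.univ :=
    Finset.union_sdiff_of_subset (Finset.subset_univ S)
  have hbad : IsBadOn H f (S ∪ (Finset.univ \ S)) := fun ψ hψ =>
    hmin.1 (IsGoodOn.hasTransversal (hunion ▸ hψ))
  have hlarge : IsLarge G (residual H f φ (Finset.univ \ S)) S :=
    IsLarge.residual_left hH (fun v hv => by
      rw [hunion, degIn_univ_eq_degree]
      exact hdeg v ((hS v).1 hv)) Finset.disjoint_sdiff φ
  rcases (hbad.residual_left Finset.disjoint_sdiff hφ).trichotomy hH hκ hnonsep hlarge with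
    h | h | h
  · refine Or.inr (Or.inl ?_)
    ext u v
    rw [SimpleGraph.comap_adj, SimpleGraph.top_adj]
    exact ⟨fun huv huv' => huv.ne (congrArg Subtype.val huv'), fun huv =>
      h u ((hS _).2 u.2) v ((hS _).2 v.2) fun h' => huv (Subtype.ext h')⟩
  · refine Or.inl (isCycleGraph_of_degree_eq_two ?_ fun v => ?_)
    · refine hF.2.1.mono fun u v huv => ?_
      exact huv.adj_sub
    · rw [degree_induce_eq_degIn hS v]
      exact h v ((hS _).2 v.2)
  · refine Or.inr (Or.inr fun v => ?_)
    rw [degree_induce_eq_degIn hS v]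
    obtain ⟨q, hq⟩ := h v ((hS _).2 v.2)
    refine hq.trans ((Nat.sub_le _ _).trans ?_)
    exact Finset.le_sup (f := fun q : Fin κ => f (v.1, q)) (Finset.mem_univ q)
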